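/- All rings are commutative with identity. For a ring $A$ and an $A$-module $E$, the trivial ring extension $A\ltimes E$ is the additive group $A\times E$ with multiplication $(a,e)(a',e')=(aa',\,ae'+a'e)$. A module $M$ over a ring $R$ is Gorenstein projective if $M\cong\operatorname{Im}(P_0\to P_1)$ for some exact complex $\cdots\to P_{-1}\to P_0\to P_1\to\cdots$ of projective $R$-modules that remains exact under $\operatorname{Hom}_R(-,Q)$ for every projective $R$-module $Q$. The Gorenstein projective dimension $\mathrm{Gpd}_R(M)\in\mathbb{N}\cup\{\infty\}$ is the least $n$ for which there is an exact sequence $0\to G_n\to\cdots\to G_0\to M\to 0$ with all $G_i$ Gorenstein projective ($\infty$ if there is no such $n$), and $\mathrm{G\text{-}gldim}(R)=\sup\{\mathrm{Gpd}_R(M)\mid M \text{ an } R\text{-module}\}$. A ring $R$ is quasi-Frobenius if it is Noetherian and injective as an $R$-module. Let $K$ be a field. Then: 1. $\mathrm{G\text{-}gldim}(K\ltimes K)=0$. Moreover $K\ltimes K\cong K[x]/(x^2)$ as $K$-algebras, and the ring $K[x]/(x^2)$ is quasi-Frobenius. 2. $\mathrm{G\text{-}gldim}(K\ltimes K^n)=\infty$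 for every integer $n\ge 2$. -/

import Mathlib

universe u

/-- `M` is Gorenstein projective over `R`: there is an exact complex
`⋯ → P (-1) → P 0 → P 1 → ⋯` of projective modules which stays exact under `Hom_R(-, Q)` for every
projective module `Q` (a complete projective resolution), and `M` is isomorphic to the image of
one of its maps (which one is immaterial, by reindexing). -/
def IsGorensteinProjective (R : Type u) [CommRing R] (M : Type u) [AddCommGroup M] [Module R M] :
    Prop :=
  ∃ (P : ℤ → Type u) (_ : ∀ i, AddCommGroup (P i)) (_ : ∀ i, Module R (P i))
    (d : ∀ i, P i →ₗ[R] P (i + 1)),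
    (∀ i, Module.Projective R (P i)) ∧
    (∀ i, Function.Exact (d i) (d (i + 1))) ∧
    (∀ (Q : Type u) [AddCommGroup Q] [Module R Q], Module.Projective R Q →
      ∀ i, Function.Exact (fun g : P (i + 1 + 1) →ₗ[R] Q => g ∘ₗ d (i + 1))
        (fun f : P (i + 1) →ₗ[R] Q => f ∘ₗ d i)) ∧
    Nonempty (M ≃ₗ[R] LinearMap.range (d 0))

/-- `M` has a Gorenstein projective resolution of length `n`: an exact sequence
`0 → G n → ⋯ → G 1 → G 0 → M → 0` with every `G i` Gorenstein projective. -/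
def HasGorensteinProjectiveResolution (R : Type u) [CommRing R] (M : Type u) [AddCommGroup M]
    [Module R M] (n : ℕ) : Prop :=
  ∃ (G : ℕ → Type u) (_ : ∀ i, AddCommGroup (G i)) (_ : ∀ i, Module R (G i))
    (d : ∀ i, G (i + 1) →ₗ[R] G i) (ε : G 0 →ₗ[R] M),
    (∀ i, IsGorensteinProjective R (G i)) ∧
    (∀ i, n < i → Subsingleton (G i)) ∧
    Function.Surjective ε ∧
    Function.Exact (d 0) ε ∧
    (∀ i, Function.Exact (d (i + 1)) (d i))

/-- The Gorenstein projective dimension `Gpd_R(M)`: the least length of a Gorenstein projective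
resolution of `M`, and `⊤` if there is none of finite length. -/
noncomputable def gorensteinProjectiveDimension (R : Type u) [CommRing R] (M : Type u)
    [AddCommGroup M] [Module R M] : ℕ∞ :=
  ⨅ (n : ℕ) (_ : HasGorensteinProjectiveResolution R M n), (n : ℕ∞)

/-- The Gorenstein global dimension: the supremum of `Gpd_R(M)` over all `R`-modules `M`. -/
noncomputable def gorensteinGlobalDimension (R : Type u) [CommRing R] : ℕ∞ :=
  ⨆ (M : Type u) (_ : AddCommGroup M) (_ : Module R M), gorensteinProjectiveDimension R M

/-- A (commutative) quasi-Frobenius ring: Noetherian and injective as a module over itself. -/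
def IsQuasiFrobenius (R : Type u) [CommRing R] : Prop :=
  IsNoetherianRing R ∧ Module.Injective R R

/-! For n = 1, any module N is the image of a map in the periodic complex of free modules `K[ε] ⊗[K]
N` with differentials ε ⊗ 1 ± 1 ⊗ ε. This complex stays exact under Hom into a projective Q because
ε, acting on Q, has a K-linear contracting homotopy.

For n ≥ 2, let 𝔪 be the square-zero ideal of R = K ⋉ K^n. `HasTrivialSyzygies` amounts to Tor₁(R/𝔪,
M) = 0. It passes along finite resolutions (`range_of_exact`), and R/𝔪 fails it, so it suffices that
Gorenstein projectives have it. In `range_of_complete`, a failure would give a map into R that can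
be extended only if e₀ • R met the line of e₁ nontrivially. -/

namespace DualNumber

/-! ### Modules over the dual numbers -/

open TensorProduct DualNumber

variable {K : Type u} [Field K]

/-- On a projective module over the dual numbers, multiplication by `ε` is a differential with a
contracting homotopy. -/
theorem exists_contractingHomotopy_of_projective {Q : Type*} [AddCommGroup Q] [Module K Q]
    [Module K[ε] Q] [IsScalarTower K K[ε] Q] [Module.Projective K[ε] Q] :
    ∃ θ : Q →ₗ[K] Q, ∀ q, θ ((ε : K[ε]) • q) + (ε : K[ε]) • θ q = q := by
  obtain ⟨s, hs⟩ := Module.Projective.out (R := K[ε]) (P := Q)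
  -- On `K[ε]` itself the homotopy is a + bε ↦ b; it is applied coordinatewise to a free module of
  -- which Q is a retract.
  let t : K[ε] →ₗ[K] K[ε] :=
    (Algebra.linearMap K K[ε]) ∘ₗ (TrivSqZeroExt.sndHom K K)
  have ht : ∀ r : K[ε], t (ε * r) + ε * t r = r := by
    intro r
    ext <;> simp [t, TrivSqZeroExt.algebraMap_eq_inl]
  let p : (Q →₀ K[ε]) →ₗ[K[ε]] Q := Finsupp.linearCombination K[ε] id
  have key : ∀ f : Q →₀ K[ε], Finsupp.mapRange.linearMap t ((ε : K[ε]) • f) +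
      (ε : K[ε]) • Finsupp.mapRange.linearMap t f = f := by
    intro f
    ext1 q
    simpa using ht (f q)
  refine ⟨p.restrictScalars K ∘ₗ Finsupp.mapRange.linearMap t ∘ₗ s.restrictScalars K, fun q => ?_⟩
  simp only [LinearMap.comp_apply, LinearMap.restrictScalars_apply]
  rw [map_smul s, ← map_smul p, ← map_add, key]
  exact hs q

variable (M : Type u) [AddCommGroup M] [Module K M] [Module K[ε] M] [IsScalarTower K K[ε] M]

/-- The map `ε ⊗ 1 + c • (1 ⊗ ε)` on `K[ε] ⊗[K] M`. -/
noncomputable def twistedMul (c : K) : K[ε] ⊗[K] M →ₗ[K[ε]] K[ε] ⊗[K] M :=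
  (LinearMap.lsmul K[ε] _ ε) + c • (Algebra.lsmul K K M (ε : K[ε])).baseChange K[ε]

variable {M}

theorem twistedMul_tmul (c : K) (r : K[ε]) (m : M) :
    twistedMul M c (r ⊗ₜ m) = (ε * r) ⊗ₜ m + c • (r ⊗ₜ ((ε : K[ε]) • m)) := by
  simp [twistedMul, TensorProduct.smul_tmul']

omit [Module K[ε] M] [IsScalarTower K K[ε] M] in
theorem exists_tmul_add_tmul (t : K[ε] ⊗[K] M) :
    ∃ a b : M, t = (1 : K[ε]) ⊗ₜ a + (ε : K[ε]) ⊗ₜ b := by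
  induction t with
  | zero => exact ⟨0, 0, by simp⟩
  | tmul r m =>
    refine ⟨TrivSqZeroExt.fst r • m, TrivSqZeroExt.snd r • m, ?_⟩
    rw [← TensorProduct.smul_tmul, ← TensorProduct.smul_tmul, ← TensorProduct.add_tmul]
    congr 1
    ext <;> simp
  | add x y hx hy =>
    obtain ⟨a, b, rfl⟩ := hx
    obtain ⟨a', b', rfl⟩ := hy
    exact ⟨a + a', b + b', by simp only [TensorProduct.tmul_add]; abel⟩

omit [Module K M] [IsScalarTower K K[ε] M] in
theorem eps_smul_eps_smul (m : M) : (ε : K[ε]) • (ε : K[ε]) • m = 0 := by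
  rw [smul_smul, eps_mul_eps, zero_smul]

theorem twistedMul_tmul_add_tmul (c : K) (a b : M) :
    twistedMul M c ((1 : K[ε]) ⊗ₜ a + (ε : K[ε]) ⊗ₜ b) =
      (1 : K[ε]) ⊗ₜ (c • (ε : K[ε]) • a) + (ε : K[ε]) ⊗ₜ (a + c • (ε : K[ε]) • b) := by
  simp only [map_add, twistedMul_tmul, eps_mul_eps, mul_one, TensorProduct.tmul_add,
    TensorProduct.tmul_smul, TensorProduct.zero_tmul]
  abel

omit [Module K[ε] M] [IsScalarTower K K[ε] M] in
theorem tmul_add_tmul_eq_zero_iff (a b : M) :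
    (1 : K[ε]) ⊗ₜ[K] a + (ε : K[ε]) ⊗ₜ[K] b = 0 ↔ a = 0 ∧ b = 0 := by
  refine ⟨fun h => ⟨?_, ?_⟩, ?_⟩
  · simpa using congrArg ((TensorProduct.lid K M).toLinearMap ∘ₗ
      (TrivSqZeroExt.fstHom K K K).toLinearMap.rTensor M) h
  · simpa using congrArg ((TensorProduct.lid K M).toLinearMap ∘ₗ
      ((TrivSqZeroExt.sndHom K K).restrictScalars K).rTensor M) h
  · rintro ⟨rfl, rfl⟩
    simp

theorem smul_eps_comm (c : K) (m : M) : (ε : K[ε]) • c • m = c • (ε : K[ε]) • m := by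
  rw [← algebraMap_smul K[ε] c m, ← algebraMap_smul K[ε] c ((ε : K[ε]) • m), smul_smul, smul_smul,
    mul_comm]

theorem twistedMul_eq_zero_iff (c : K) (a b : M) :
    twistedMul M c ((1 : K[ε]) ⊗ₜ a + (ε : K[ε]) ⊗ₜ b) = 0 ↔ a + c • (ε : K[ε]) • b = 0 := by
  rw [twistedMul_tmul_add_tmul, tmul_add_tmul_eq_zero_iff]
  refine ⟨fun h => h.2, fun h => ⟨?_, h⟩⟩
  rw [eq_neg_of_add_eq_zero_left h, smul_neg, smul_eps_comm, eps_smul_eps_smul]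
  simp

/-- The kernel for -c consists of the elements 1 ⊗ cεb + ε ⊗ b, which are the images of 1 ⊗ b under
the map for c. -/
theorem exact_twistedMul (c : K) :
    Function.Exact (twistedMul M c) (twistedMul M (-c)) := by
  intro t
  constructor
  · intro h
    obtain ⟨a, b, rfl⟩ := exists_tmul_add_tmul t
    rw [twistedMul_eq_zero_iff] at h
    refine ⟨(1 : K[ε]) ⊗ₜ b, ?_⟩
    have := twistedMul_tmul_add_tmul c b 0
    simp only [TensorProduct.tmul_zero, smul_zero, add_zero] at this
    rw [this, neg_smul, add_neg_eq_zero] at *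
    rw [h]
  · rintro ⟨s, rfl⟩
    obtain ⟨a, b, rfl⟩ := exists_tmul_add_tmul s
    rw [twistedMul_tmul_add_tmul, twistedMul_eq_zero_iff, smul_add,
      smul_eps_comm, eps_smul_eps_smul]
    simp

theorem exact_comp_twistedMul {c : K} (hc : c * c = 1) (Q : Type*) [AddCommGroup Q]
    [Module K[ε] Q] [Module.Projective K[ε] Q] :
    Function.Exact (fun g : K[ε] ⊗[K] M →ₗ[K[ε]] Q => g ∘ₗ twistedMul M (-c))
      (fun f : K[ε] ⊗[K] M →ₗ[K[ε]] Q => f ∘ₗ twistedMul M c) := by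
  intro f
  constructor
  · intro h
    let _ : Module K Q := Module.compHom Q (algebraMap K K[ε])
    have _ : IsScalarTower K K[ε] Q := .of_algebraMap_smul fun _ _ => rfl
    obtain ⟨θ, hθ⟩ := exists_contractingHomotopy_of_projective (K := K) (Q := Q)
    -- The preimage is 1 ⊗ a ↦ θ (f (1 ⊗ a)). As f kills the image of the differential, f (1 ⊗ εa) =
    -- -cε f (1 ⊗ a), and c² = 1 turns the claim into θε + εθ = 1.
    refine ⟨LinearMap.liftBaseChange K[ε]
      (θ ∘ₗ f.restrictScalars K ∘ₗ TensorProduct.mk K K[ε] M 1), ?_⟩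
    have h1 (a : M) : f ((1 : K[ε]) ⊗ₜ ((ε : K[ε]) • a)) = -(c • (ε : K[ε]) • f (1 ⊗ₜ a)) := by
      have := LinearMap.congr_fun h ((1 : K[ε]) ⊗ₜ a)
      simp only [LinearMap.comp_apply, twistedMul_tmul, map_add, LinearMap.zero_apply] at this
      rw [LinearMap.map_smul_of_tower, ← smul_eq_mul, ← TensorProduct.smul_tmul', map_smul,
        add_eq_zero_iff_eq_neg] at this
      rw [this, smul_neg, neg_neg, smul_smul, hc, one_smul]
    apply TensorProduct.AlgebraTensorModule.ext
    intro r a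
    have h2 := hθ (f (1 ⊗ₜ a))
    rw [← mul_one r, ← smul_eq_mul, ← TensorProduct.smul_tmul', map_smul, map_smul]
    congr 1
    simp only [LinearMap.comp_apply, twistedMul_tmul, map_add, LinearMap.map_smul_of_tower,
      LinearMap.liftBaseChange_tmul, mul_one, one_smul, LinearMap.restrictScalars_apply,
      TensorProduct.mk_apply, h1, map_neg, smul_neg, neg_smul, neg_neg]
    rw [smul_smul, hc, one_smul, add_comm]
    exact h2
  · rintro ⟨g, rfl⟩
    refine LinearMap.ext fun t => ?_
    simp [(exact_twistedMul (M := M) c).apply_apply_eq_zero t]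

/-- Every module over the dual numbers of a field is Gorenstein projective. -/
theorem isGorensteinProjective (N : Type u) [AddCommGroup N] [Module K[ε] N] :
    IsGorensteinProjective K[ε] N := by
  let _ : Module K N := Module.compHom N (algebraMap K K[ε])
  have _ : IsScalarTower K K[ε] N := .of_algebraMap_smul fun _ _ => rfl
  let s : ℤ → K := fun i => if Even i then 1 else -1
  have hs (i : ℤ) : s (i + 1) = -s i := by
    by_cases h : Even i <;> simp [s, h]
  have hs' (i : ℤ) : s i * s i = 1 := by
    by_cases h : Even i <;> simp [s, h]
  refine ⟨fun _ => K[ε] ⊗[K] N, inferInstance, inferInstance, fun i => twistedMul N (s i),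
    fun i => inferInstance, fun i => ?_, fun Q _ _ _ i => ?_, ⟨?_⟩⟩
  · simpa only [hs] using exact_twistedMul (s i)
  · simpa only [hs] using exact_comp_twistedMul (hs' i) Q
  · let ρ : K[ε] ⊗[K] N →ₗ[K[ε]] N := LinearMap.liftBaseChange K[ε] LinearMap.id
    have hρ : Function.Surjective ρ := fun a => ⟨1 ⊗ₜ a, by simp [ρ]⟩
    -- Both kernels are given by a + εb = 0, since the sign at index 0 is 1; so N and the range are
    -- the same quotient.
    have hker : LinearMap.ker ρ = LinearMap.ker (twistedMul N (s 0)) := by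
      ext t
      obtain ⟨a, b, rfl⟩ := exists_tmul_add_tmul t
      rw [LinearMap.mem_ker, LinearMap.mem_ker, twistedMul_eq_zero_iff]
      simp [ρ, s]
    exact (ρ.quotKerEquivOfSurjective hρ).symm.trans
      ((Submodule.quotEquivOfEq _ _ hker).trans (LinearMap.quotKerEquivRange _))

-- `K[ε]` is coinduced from K: a linear map into it is determined by its ε-coordinate, any K-linear
-- functional φ, as y ↦ φ(εy) + φ(y)ε. Functionals extend along injections over a field.
variable (K) in
theorem injective_self : Module.Injective K[ε] K[ε] := by
  refine ⟨fun X Y _ _ _ _ f hf g => ?_⟩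
  let _ : Module K X := Module.compHom X (algebraMap K K[ε])
  have _ : IsScalarTower K K[ε] X := .of_algebraMap_smul fun _ _ => rfl
  let _ : Module K Y := Module.compHom Y (algebraMap K K[ε])
  have _ : IsScalarTower K K[ε] Y := .of_algebraMap_smul fun _ _ => rfl
  obtain ⟨l, hl⟩ := (f.restrictScalars K).exists_leftInverse_of_injective
    (LinearMap.ker_eq_bot.mpr hf)
  let φ : Y →ₗ[K] K := ((TrivSqZeroExt.sndHom K K).restrictScalars K ∘ₗ g.restrictScalars K) ∘ₗ l
  have hφ (x : X) : φ (f x) = (g x).snd := by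
    have := LinearMap.congr_fun hl x
    simp only [LinearMap.comp_apply, LinearMap.restrictScalars_apply, LinearMap.id_apply] at this
    simp [φ, this]
  have hsmul (r : K[ε]) (y : Y) : r • y = r.fst • y + r.snd • (ε : K[ε]) • y := by
    rw [← smul_assoc r.snd, ← algebraMap_smul K[ε] r.fst y, ← add_smul]
    congr 1
    ext <;> simp [TrivSqZeroExt.algebraMap_eq_inl]
  refine ⟨{ toFun := fun y => TrivSqZeroExt.inl (φ ((ε : K[ε]) • y)) + TrivSqZeroExt.inr (φ y)
            map_add' := fun y z => ?_
            map_smul' := fun r y => ?_ }, fun x => ?_⟩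
  · ext <;> simp
  · rw [smul_comm, hsmul r, hsmul r]
    ext <;> simp [eps_smul_eps_smul, mul_comm]
  · change TrivSqZeroExt.inl (φ ((ε : K[ε]) • f x)) + TrivSqZeroExt.inr (φ (f x)) = g x
    rw [← map_smul, hφ, hφ]
    ext <;> simp

variable (K) in
/-- The dual numbers are `K[x] / (x ^ 2)`. -/
theorem nonempty_algEquiv : Nonempty
    ((Polynomial K ⧸ Ideal.span {(Polynomial.X ^ 2 : Polynomial K)}) ≃ₐ[K] K[ε]) := by
  let I : Ideal (Polynomial K) := Ideal.span {(Polynomial.X ^ 2 : Polynomial K)}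
  let x : Polynomial K ⧸ I := Ideal.Quotient.mk I Polynomial.X
  have hx : x * x = 0 := by
    rw [← map_mul, ← pow_two]
    exact Ideal.Quotient.eq_zero_iff_mem.mpr (Ideal.mem_span_singleton_self _)
  let F : (Polynomial K ⧸ I) →ₐ[K] K[ε] := Ideal.Quotient.liftₐ I (Polynomial.aeval ε) (by
    intro a ha
    obtain ⟨b, rfl⟩ := Ideal.mem_span_singleton'.mp ha
    simp [eps_pow_two])
  let G : K[ε] →ₐ[K] (Polynomial K ⧸ I) :=
    DualNumber.lift ⟨(Algebra.ofId K _, x), hx, fun a => mul_comm _ _⟩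
  have hG : G ε = x := DualNumber.lift_apply_eps _
  have hF : F x = ε := by
    change Polynomial.aeval ε Polynomial.X = _
    simp
  refine ⟨AlgEquiv.ofAlgHom F G ?_ ?_⟩
  · apply DualNumber.algHom_ext
    simp [hG, hF]
  · apply Ideal.Quotient.algHom_ext
    apply Polynomial.algHom_ext
    change G (F x) = x
    rw [hF, hG]

end DualNumber

theorem gorensteinProjectiveDimension_eq_zero {R : Type u} [CommRing R]
    (h : ∀ (N : Type u) [AddCommGroup N] [Module R N], IsGorensteinProjective R N)
    (M : Type u) [AddCommGroup M] [Module R M] : gorensteinProjectiveDimension R M = 0 := by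
  have key : HasGorensteinProjectiveResolution R M 0 := by
    let S : ℕ → Submodule R M := fun i => if i = 0 then ⊤ else ⊥
    have hsub (i : ℕ) : Subsingleton (S (i + 1)) := by
      simp only [S, Nat.add_eq_zero_iff, one_ne_zero, and_false, if_false]
      infer_instance
    refine ⟨fun i => S i, inferInstance, inferInstance, fun i => 0, (S 0).subtype,
      fun i => h _, fun i hi => ?_, fun m => ⟨⟨m, by simp [S]⟩, rfl⟩, ?_, fun i y => ?_⟩
    · obtain ⟨j, rfl⟩ := Nat.exists_eq_succ_of_ne_zero hi.ne'
      exact hsub j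
    · intro y
      simp [eq_comm]
    · have := hsub i
      simp [Subsingleton.elim y 0]
  exact le_antisymm (iInf₂_le_of_le 0 key le_rfl) bot_le

theorem DualNumber.isQuasiFrobenius_quotient (K : Type u) [Field K] :
    IsQuasiFrobenius (Polynomial K ⧸ Ideal.span {(Polynomial.X ^ 2 : Polynomial K)}) := by
  obtain ⟨e⟩ := nonempty_algEquiv K
  let _ := RingHomInvPair.of_ringEquiv e.symm.toRingEquiv
  have := injective_self K
  exact ⟨inferInstance, Module.Injective.of_ringEquiv e.symm.toRingEquiv
    e.symm.toRingEquiv.toSemilinearEquiv⟩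

/-- The trivial extension `K ⋉ K ^ n`. -/
abbrev VecExt (K : Type u) [Field K] (n : ℕ) : Type u := TrivSqZeroExt K (Fin n → K)

/-! ### Trivial extensions by K^n and vanishing of Tor₁ -/

namespace VecExt

open TrivSqZeroExt

variable (K : Type u) [Field K] {n : ℕ}

/-- The generators of the square-zero ideal of `K ⋉ K ^ n`. -/
def gen (j : Fin n) : VecExt K n :=
  inr (Pi.single j 1)

theorem gen_mul (j : Fin n) (r : VecExt K n) : gen K j * r = inr (r.fst • Pi.single j 1) := by
  ext <;> simp [gen]

theorem gen_mul_gen (i j : Fin n) : gen K i * gen K j = 0 := by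
  simp [gen]

theorem inr_eq_sum (v : Fin n → K) : (inr v : VecExt K n) = ∑ j, gen K j * inl (v j) := by
  simp_rw [gen_mul, ← inr_sum, fst_inl]
  congr 1
  ext i
  simp [Finset.sum_apply, Pi.single_apply]

variable (n)

/-- The map `(y_j) ↦ ∑ e_j y_j`, with range the product of `M` with the square-zero ideal. -/
noncomputable def genSum (M : Type*) [AddCommGroup M] [Module (VecExt K n) M] :
    (Fin n → M) →ₗ[VecExt K n] M :=
  ∑ j, gen K j • LinearMap.proj j

/-- Every relation `∑ e_j y_j = 0` in `M` has all its terms `y_j` in the product of `M` with the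
square-zero ideal. -/
def HasTrivialSyzygies (M : Type*) [AddCommGroup M] [Module (VecExt K n) M] : Prop :=
  ∀ y : Fin n → M, genSum K n M y = 0 → ∀ j, y j ∈ LinearMap.range (genSum K n M)

variable {K n}
variable {M N A B C D : Type*} [AddCommGroup M] [Module (VecExt K n) M]
  [AddCommGroup N] [Module (VecExt K n) N] [AddCommGroup A] [Module (VecExt K n) A]
  [AddCommGroup B] [Module (VecExt K n) B] [AddCommGroup C] [Module (VecExt K n) C]
  [AddCommGroup D] [Module (VecExt K n) D]

theorem genSum_apply (y : Fin n → M) : genSum K n M y = ∑ j, gen K j • y j := by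
  simp [genSum]

theorem map_genSum (f : M →ₗ[VecExt K n] N) (y : Fin n → M) :
    f (genSum K n M y) = genSum K n N (fun j => f (y j)) := by
  simp [genSum_apply]

theorem gen_smul_genSum (i : Fin n) (y : Fin n → M) : gen K i • genSum K n M y = 0 := by
  rw [genSum_apply, Finset.smul_sum]
  simp [smul_smul, gen_mul_gen]

theorem smul_mem_range_genSum {r : VecExt K n} (hr : r.fst = 0) (m : M) :
    r • m ∈ LinearMap.range (genSum K n M) := by
  refine ⟨fun j => (inl (r.snd j) : VecExt K n) • m, ?_⟩
  have : r = inr r.snd := by ext <;> simp [hr]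
  rw [genSum_apply]
  conv_rhs => rw [this, inr_eq_sum, Finset.sum_smul]
  simp [smul_smul]

theorem map_mem_range_genSum (f : M →ₗ[VecExt K n] N) {m : M}
    (hm : m ∈ LinearMap.range (genSum K n M)) : f m ∈ LinearMap.range (genSum K n N) := by
  obtain ⟨y, rfl⟩ := hm
  exact ⟨_, (map_genSum f y).symm⟩

theorem HasTrivialSyzygies.of_equiv (e : M ≃ₗ[VecExt K n] N) (h : HasTrivialSyzygies K n M) :
    HasTrivialSyzygies K n N := by
  intro y hy j
  have := h (fun j => e.symm (y j)) (by
    have := map_genSum e.symm.toLinearMap y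
    rw [hy, map_zero] at this
    exact this.symm) j
  simpa using map_mem_range_genSum e.toLinearMap this

theorem HasTrivialSyzygies.of_subsingleton [Subsingleton M] : HasTrivialSyzygies K n M :=
  fun _ _ _ => ⟨0, Subsingleton.elim _ _⟩

theorem HasTrivialSyzygies.of_projective [Module.Projective (VecExt K n) M] :
    HasTrivialSyzygies K n M := by
  obtain ⟨s, hs⟩ := Module.Projective.out (R := VecExt K n) (P := M)
  intro y hy j
  rw [← hs (y j), Finsupp.linearCombination_apply]
  refine Submodule.sum_mem _ fun p _ => smul_mem_range_genSum ?_ _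
  have h := DFunLike.congr_fun (map_genSum s y) p
  rw [hy, map_zero, genSum_apply] at h
  have h2 : ∑ i, gen K i * s (y i) p = 0 := by simpa [Finsupp.finsetSum_apply] using h.symm
  simp_rw [gen_mul, ← inr_sum] at h2
  have h3 := congrFun (congrArg snd h2) j
  simpa [Finset.sum_apply, Pi.single_apply] using h3

/-- A relation in the range of g lifts to an element of 𝔪B lying in the range of f. If it lies in
f(𝔪A), subtracting f(t) from the lifts gives a true relation in B. -/
theorem HasTrivialSyzygies.range_of_lift {f : A →ₗ[VecExt K n] B} {g : B →ₗ[VecExt K n] C}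
    (hfg : Function.Exact f g)
    (hf : ∀ x a, f a = genSum K n B x → ∃ y, f (genSum K n A y) = f a)
    (hB : HasTrivialSyzygies K n B) : HasTrivialSyzygies K n (LinearMap.range g) := by
  intro y hy j
  choose x hx using fun j => g.surjective_rangeRestrict (y j)
  obtain rfl : (fun j => g.rangeRestrict (x j)) = y := funext hx
  have hz : g (genSum K n B x) = 0 := by
    rw [← map_genSum] at hy
    exact congrArg Subtype.val hy
  obtain ⟨a, ha⟩ := (hfg _).mp hz
  obtain ⟨t, ht⟩ := hf x a ha
  have h0 : genSum K n B (x - fun j => f (t j)) = 0 := by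
    rw [map_sub, ← map_genSum, ht, ha, sub_self]
  have h1 := map_mem_range_genSum g.rangeRestrict (hB _ h0 j)
  have h2 : g.rangeRestrict (f (t j)) = 0 := Subtype.ext (hfg.apply_apply_eq_zero _)
  simpa [h2] using h1

theorem HasTrivialSyzygies.range_of_exact {f : A →ₗ[VecExt K n] B} {g : B →ₗ[VecExt K n] C}
    (hfg : Function.Exact f g) (hA : HasTrivialSyzygies K n (LinearMap.range f))
    (hB : HasTrivialSyzygies K n B) : HasTrivialSyzygies K n (LinearMap.range g) := by
  rcases isEmpty_or_nonempty (Fin n) with _ | ⟨⟨j⟩⟩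
  · exact fun _ _ j => isEmptyElim j
  refine .range_of_lift hfg (fun x a hxa => ?_) hB
  -- Since f a lies in 𝔪B and 𝔪² = 0, each e_j kills it; this one-term relation puts f a in 𝔪 ·
  -- range f.
  have hz : genSum K n _ (Pi.single j (f.rangeRestrict a)) = 0 := by
    rw [genSum_apply, Finset.sum_eq_single j (fun i _ hi => by simp [hi]) (by simp)]
    rw [Pi.single_eq_same]
    exact Subtype.ext (by simp [hxa, gen_smul_genSum])
  obtain ⟨y, hy⟩ := hA _ hz j
  rw [Pi.single_eq_same] at hy
  choose t ht using fun j => f.surjective_rangeRestrict (y j)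
  obtain rfl : (fun j => f.rangeRestrict (t j)) = y := funext ht
  rw [← map_genSum] at hy
  exact ⟨t, congrArg Subtype.val hy⟩

/-- Such a μ is R-linear into R/𝔪 = K, so it lifts along the surjection R → K. -/
theorem exists_fst_eq_of_projective [Module K B] [IsScalarTower K (VecExt K n) B]
    [Module.Projective (VecExt K n) B] (μ : B →ₗ[K] K) (hμ : ∀ y, μ (genSum K n B y) = 0) :
    ∃ α : B →ₗ[VecExt K n] VecExt K n, ∀ x, (α x).fst = μ x := by
  obtain ⟨s, hs⟩ := Module.Projective.out (R := VecExt K n) (P := B)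
  have hsmul (r : VecExt K n) (p : B) : μ (r • p) = r.fst * μ p := by
    have hr : r = algebraMap K (VecExt K n) r.fst + inr r.snd := by
      ext <;> simp [TrivSqZeroExt.algebraMap_eq_inl]
    obtain ⟨y, hy⟩ := smul_mem_range_genSum (r := (inr r.snd : VecExt K n)) (by simp) p
    conv_lhs => rw [hr, add_smul, algebraMap_smul, ← hy, map_add, hμ, add_zero, map_smul]
    rfl
  refine ⟨Finsupp.linearCombination (VecExt K n) (fun p => (inl (μ p) : VecExt K n)) ∘ₗ s,
    fun x => ?_⟩
  conv_rhs => rw [← hs x, Finsupp.linearCombination_apply, Finsupp.sum, map_sum]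
  simp [Finsupp.linearCombination_apply, Finsupp.sum, hsmul, fst_sum]

theorem HasTrivialSyzygies.range_of_complete (hn : 2 ≤ n)
    [Module.Projective (VecExt K n) B] [Module.Projective (VecExt K n) C]
    {a₀ : D →ₗ[VecExt K n] A} {a : A →ₗ[VecExt K n] B} {b : B →ₗ[VecExt K n] C}
    {c : C →ₗ[VecExt K n] M} (h₀ : Function.Exact a₀ a) (hab : Function.Exact a b)
    (hbc : Function.Exact b c)
    (hext : ∀ f : A →ₗ[VecExt K n] VecExt K n, f ∘ₗ a₀ = 0 → ∃ g, g ∘ₗ a = f) :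
    HasTrivialSyzygies K n (LinearMap.range c) := by
  refine .range_of_lift hbc (fun x w hw => ?_) .of_projective
  by_contra! hcon
  let _ : Module K B := Module.compHom B (algebraMap K (VecExt K n))
  have _ : IsScalarTower K (VecExt K n) B := .of_algebraMap_smul fun _ _ => rfl
  have hmem : w ∉ (LinearMap.range (genSum K n B) ⊔ LinearMap.ker b).restrictScalars K := by
    rw [Submodule.restrictScalars_mem, Submodule.mem_sup]
    rintro ⟨_, ⟨y, rfl⟩, k, hk, rfl⟩
    exact hcon y (by rw [map_add, LinearMap.mem_ker.mp hk, add_zero])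
  obtain ⟨μ, hμw, hμ⟩ := Submodule.exists_le_ker_of_notMem hmem
  obtain ⟨α, hα⟩ := exists_fst_eq_of_projective μ fun y =>
    hμ (Submodule.mem_sup_left (LinearMap.mem_range_self _ y))
  have hαa (t : A) : (α (a t)).fst = 0 := by
    rw [hα]
    exact hμ (Submodule.mem_sup_right (hab.apply_apply_eq_zero t))
  let i₀ : Fin n := ⟨0, by omega⟩
  let i₁ : Fin n := ⟨1, by omega⟩
  have hne : i₁ ≠ i₀ := by simp [i₀, i₁]
  -- Moving coordinate i₀ to i₁ is linear on 𝔪, where α ∘ a takes its values. If e₀w = a t, then f t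
  -- = μ(w)e₁, while g (e₀w) = e₀ • g w has no e₁-coordinate; hence μ(w) = 0.
  let f : A →ₗ[VecExt K n] VecExt K n :=
    { toFun := fun t => inr ((α (a t)).snd i₀ • Pi.single i₁ 1)
      map_add' := fun s t => by simp [add_smul]
      map_smul' := fun r t => by ext <;> simp [hαa, mul_assoc, mul_left_comm] }
  obtain ⟨g, hg⟩ := hext f (LinearMap.ext fun t => by simp [f, h₀.apply_apply_eq_zero])
  obtain ⟨t, ht⟩ := (hab (gen K i₀ • w)).mp (by rw [map_smul, hw, gen_smul_genSum])
  have h1 := LinearMap.congr_fun hg t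
  rw [LinearMap.comp_apply, ht, map_smul] at h1
  have h2 := congrFun (congrArg snd h1) i₁
  simp [f, ht, gen_mul, hne] at h2
  exact hμw (by rw [← hα, h2])

theorem HasTrivialSyzygies.of_isGorensteinProjective (hn : 2 ≤ n) {G : Type u} [AddCommGroup G]
    [Module (VecExt K n) G] (hG : IsGorensteinProjective (VecExt K n) G) :
    HasTrivialSyzygies K n G := by
  obtain ⟨P, _, _, d, hP, hd, hhom, ⟨e⟩⟩ := hG
  -- `range_of_complete` needs three maps preceding `d 0`.
  obtain ⟨i, hi⟩ : ∃ i : ℤ, i + 1 + 1 + 1 = 0 := ⟨-3, rfl⟩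
  rw [← hi] at e
  exact .of_equiv e.symm (.range_of_complete hn (hd i) (hd (i + 1)) (hd (i + 1 + 1))
    fun f hf => (hhom (VecExt K n) inferInstance i f).mp hf)

theorem gorensteinGlobalDimension_eq_top (K : Type u) [Field K] {n : ℕ} (hn : 2 ≤ n) :
    gorensteinGlobalDimension (VecExt K n) = ⊤ := by
  let I : Ideal (VecExt K n) := RingHom.ker (fstHom K K (Fin n → K))
  refine top_unique (le_trans ?_ (le_iSup_of_le (VecExt K n ⧸ I)
    (le_iSup_of_le inferInstance (le_iSup_of_le inferInstance le_rfl))))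
  refine le_iInf₂ fun m hm => ?_
  obtain ⟨G, _, _, d, ε, hG, hsub, hε, hdε, hd⟩ := hm
  exfalso
  have hG' (i : ℕ) := HasTrivialSyzygies.of_isGorensteinProjective hn (hG i)
  -- Descent along the resolution, starting from the zero range of `d m`.
  have key (i : ℕ) (hi : i ≤ m) : HasTrivialSyzygies K n (LinearMap.range (d i)) := by
    induction hi using Nat.decreasingInduction with
    | self =>
      have := hsub (m + 1) (by omega)
      have : Subsingleton (LinearMap.range (d m)) :=
        (d m).surjective_rangeRestrict.subsingleton
      exact .of_subsingleton
    | of_succ i _ ih => exact .range_of_exact (hd i) ih (hG' (i + 1))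
  have hM : HasTrivialSyzygies K n (VecExt K n ⧸ I) :=
    .of_equiv (LinearEquiv.ofTop _ (LinearMap.range_eq_top.mpr hε))
      (.range_of_exact hdε (key 0 (Nat.zero_le m)) (hG' 0))
  have hkill (j : Fin n) (q : VecExt K n ⧸ I) : gen K j • q = 0 := by
    obtain ⟨r, rfl⟩ := Ideal.Quotient.mk_surjective q
    rw [← Ideal.Quotient.mk_eq_mk, ← Submodule.Quotient.mk_smul, Ideal.Quotient.mk_eq_mk]
    exact Ideal.Quotient.eq_zero_iff_mem.mpr (by simp [I, RingHom.mem_ker, gen])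
  -- As 𝔪 kills R/𝔪, the constant family 1 is a relation, which would force 1 = 0.
  obtain ⟨y, hy⟩ := hM (fun _ => 1) (by simp [genSum_apply, hkill]) ⟨0, by omega⟩
  have : Nontrivial (VecExt K n ⧸ I) := Ideal.Quotient.nontrivial_iff.mpr (RingHom.ker_ne_top _)
  exact one_ne_zero (hy.symm.trans (by simp [genSum_apply, hkill]))

end VecExt

theorem mainTheorem7 (K : Type u) [Field K] :
    (gorensteinGlobalDimension (TrivSqZeroExt K K) = 0 ∧
      Nonempty ((Polynomial K ⧸ Ideal.span {(Polynomial.X ^ 2 : Polynomial K)}) ≃ₐ[K]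
        TrivSqZeroExt K K) ∧
      IsQuasiFrobenius (Polynomial K ⧸ Ideal.span {(Polynomial.X ^ 2 : Polynomial K)})) ∧
    ∀ n : ℕ, 2 ≤ n → gorensteinGlobalDimension (TrivSqZeroExt K (Fin n → K)) = ⊤ := by
  refine ⟨⟨?_, DualNumber.nonempty_algEquiv K, DualNumber.isQuasiFrobenius_quotient K⟩,
    fun n hn => VecExt.gorensteinGlobalDimension_eq_top K hn⟩
  refine bot_unique (iSup_le fun M => iSup_le fun _ => iSup_le fun _ => ?_)
  exact (gorensteinProjectiveDimension_eq_zero DualNumber.isGorensteinProjective M).le
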